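/- Let $N$ be a positive integer and let $k_1,\dots,k_N,b_1,\dots,b_N$ be nonzero complex constants such that $k_j^2\neq k_l^2$ for $j\neq l$ and $k_j^2\neq \bar k_l^2$ for all $j,l$ (that is, the points $\pm k_j,\pm\bar k_j$ are pairwise distinct). Write $\sigma_2=\begin{pmatrix}0&-i\\ i&0\end{pmatrix}$, $\sigma_3=\mathrm{diag}(1,-1)$, $\theta(x,t,k)=k^2x+2k^4t$. The $N$-soliton of the Gerdjikov–Ivanov (GI) equation $$iq_t+q_{xx}-iq^2\bar q_x+\tfrac12 q^3\bar q^2=0,\qquad (x,t)\in\mathbb R^2,$$ with data $\{k_j,b_j\}$ is the potential obtained by dressing the zero seed $q_0=0$, with eigenfunction $\psi_0=\exp(-i\theta\sigma_3)$: $$q=q_0+4i\sum_{j=1}^N (A_j)_{12},\qquad A_j=\frac1{a_j}\begin{pmatrix}r_j\\ s_j\end{pmatrix}(b_j,\,b_j^{-1})\,\psi_0^{-1}(k_j),\qquad a_j=\frac{2k_j}{k_j^2-\bar k_j^2}\prod_{m\ne j}\frac{k_j^2-k_m^2}{k_j^2-\bar k_m^2},$$ where, at each $(x,t)$, $\{r_j,s_j\}_{j=1}^N$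 solves the linear algebraic system $$G(\bar k_l)\,\sigma_2\,\overline{\psi_0(k_l)}\begin{pmatrix}\bar b_l^{-1}\\ -\bar b_l\end{pmatrix}=0\quad(l=1,\dots,N),\qquad G(k)=I+\sum_{j=1}^N\left[\frac{A_j}{k-k_j}-\frac{\sigma_3A_j\sigma_3}{k+k_j}\right].$$ Put $$p_l=b_l\,e^{i(k_l^2x+2k_l^4t)},\qquad K_{jl}=\frac{k_j\,p_j^2\,\bar p_l^{\,2}+\bar k_l}{k_j^2-\bar k_l^2}\qquad(1\le j,l\le N).$$ Then for all $(x,t)\in\mathbb R^2$ the matrix $K=K(x,t)$ is invertible, the linear system has exactly one solution $\{r_j,s_j\}_{j=1}^N$, and the $N$-soliton is given by $$q(x,t)=2i\sum_{l,j=1}^N\bar p_l^{\,2}\,(K^{-1})_{lj};$$ moreover this $q$ is a $C^\infty$ function on $\mathbb R^2$ and satisfies the GI equation everywhere. -/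

import Mathlib

open Matrix
open scoped ComplexConjugate ContDiff

noncomputable section

namespace GerdjikovIvanov

/-- The Gerdjikov-Ivanov equation
`i q_t + q_xx - i q² (q̄)_x + (1/2) q³ q̄² = 0` at every point `(x, t)` of the plane. -/
def SolvesGI (q : ℝ → ℝ → ℂ) : Prop :=
  ∀ x t : ℝ,
    Complex.I * deriv (fun τ : ℝ => q x τ) t
      + deriv (fun y : ℝ => deriv (fun z : ℝ => q z t) y) x
      - Complex.I * q x t ^ 2 * deriv (fun y : ℝ => conj (q y t)) x
      + (1 / 2 : ℂ) * q x t ^ 3 * conj (q x t) ^ 2 = 0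

def σ₂ : Matrix (Fin 2) (Fin 2) ℂ := !![0, -Complex.I; Complex.I, 0]

def σ₃ : Matrix (Fin 2) (Fin 2) ℂ := !![1, 0; 0, -1]

/-- The phase `θ = z² x + 2 z⁴ t`. -/
def theta (z : ℂ) (x t : ℝ) : ℂ := z ^ 2 * x + 2 * z ^ 4 * t

/-- The eigenfunction `ψ₀ = exp (-i θ σ₃)` of the zero seed `q₀ = 0`. -/
def zeroSeedEigenfunction (x t : ℝ) (z : ℂ) : Matrix (Fin 2) (Fin 2) ℂ :=
  NormedSpace.exp (-(Complex.I * theta z x t) • σ₃)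

variable {N : ℕ}

/-- `a_j = 2 k_j / (k_j² - k̄_j²) * ∏_{m ≠ j} (k_j² - k_m²) / (k_j² - k̄_m²)`. -/
def aCoeff (k : Fin N → ℂ) (j : Fin N) : ℂ :=
  2 * k j / (k j ^ 2 - conj (k j) ^ 2)
    * ∏ m ∈ Finset.univ.erase j, (k j ^ 2 - k m ^ 2) / (k j ^ 2 - conj (k m) ^ 2)

/-- The residue `A_j = a_j⁻¹ (r_j, s_j)ᵀ (b_j, b_j⁻¹) ψ₀(k_j)⁻¹`, where `v j = (r_j, s_j)` and
`ψ₀ : ℂ → Matrix (Fin 2) (Fin 2) ℂ` is the seed eigenfunction at a fixed point `(x, t)`. -/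
def residue (ψ₀ : ℂ → Matrix (Fin 2) (Fin 2) ℂ) (k b : Fin N → ℂ) (v : Fin N → Fin 2 → ℂ)
    (j : Fin N) : Matrix (Fin 2) (Fin 2) ℂ :=
  (aCoeff k j)⁻¹ • (vecMulVec (v j) ![b j, (b j)⁻¹] * (ψ₀ (k j))⁻¹)

/-- The dressing factor `G(z) = I + ∑_j [A_j / (z - k_j) - σ₃ A_j σ₃ / (z + k_j)]`. -/
def dressingFactor (k : Fin N → ℂ) (A : Fin N → Matrix (Fin 2) (Fin 2) ℂ) (z : ℂ) :
    Matrix (Fin 2) (Fin 2) ℂ :=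
  1 + ∑ j, ((z - k j)⁻¹ • A j - (z + k j)⁻¹ • (σ₃ * A j * σ₃))

/-- The linear algebraic system for the unknown vectors `v j = (r_j, s_j)`:
`G(k̄_l) σ₂ conj(ψ₀(k_l)) (b̄_l⁻¹, -b̄_l)ᵀ = 0` for `l = 1, …, N`. -/
def DressingSystem (ψ₀ : ℂ → Matrix (Fin 2) (Fin 2) ℂ) (k b : Fin N → ℂ)
    (v : Fin N → Fin 2 → ℂ) : Prop :=
  ∀ l : Fin N,
    dressingFactor k (residue ψ₀ k b v) (conj (k l)) *ᵥ
      (σ₂ *ᵥ ((ψ₀ (k l)).map conj *ᵥ ![(conj (b l))⁻¹, -conj (b l)])) = 0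

/-- The dressed potential `q = q₀ + 4 i ∑_j (A_j)₁₂` (value at a fixed point `(x, t)`). -/
def dressedPotential (q₀ : ℂ) (A : Fin N → Matrix (Fin 2) (Fin 2) ℂ) : ℂ :=
  q₀ + 4 * Complex.I * ∑ j, A j 0 1

/-- `p_l = b_l exp (i (k_l² x + 2 k_l⁴ t))`. -/
def p (k b : Fin N → ℂ) (x t : ℝ) (l : Fin N) : ℂ :=
  b l * Complex.exp (Complex.I * (k l ^ 2 * x + 2 * k l ^ 4 * t))

/-- `K_{jl} = (k_j p_j² p̄_l² + k̄_l) / (k_j² - k̄_l²)`. -/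
def solitonMatrix (k b : Fin N → ℂ) (x t : ℝ) : Matrix (Fin N) (Fin N) ℂ :=
  Matrix.of fun j l =>
    (k j * p k b x t j ^ 2 * conj (p k b x t l) ^ 2 + conj (k l)) / (k j ^ 2 - conj (k l) ^ 2)

/-- `2 i ∑_{l,j} p̄_l² (K⁻¹)_{lj}`. -/
def solitonFormula (k b : Fin N → ℂ) (x t : ℝ) : ℂ :=
  2 * Complex.I * ∑ l, ∑ j, conj (p k b x t l) ^ 2 * (solitonMatrix k b x t)⁻¹ l j

end GerdjikovIvanov

end

/-!
The whole argument runs through the matrix `K = cauchyMatrix k f` with `f = p²` and the bilinear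
form `pairing k f a b = aᵀ K⁻¹ b`; no Lax pair is needed.

*Invertibility* (`det_cauchyMatrix_ne_zero`). A left null vector of `K` yields two rational functions
`w₁, w₂` of `s` with poles `k j ^ 2` such that `|w₁|² + s |w₂|² = 0` for all real `s > 0`. Hence
`w₂ = 0`, and the null vector vanishes. This works for any distribution of the points `k j ^ 2`
between the two half-planes.

*The dressing system* (`dressingSystem_iff`). Its two rows are linear systems with matrices `K` and
`Kᴴ`, which gives unique solvability and the formula for `q`.

*The equation* (`solvesGI_reducedPotential`). Write `φ = f̄`, `g = k f`, and let `1` be the constant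
vector. The Sylvester equation `Λ K - K Λ̄ = g φᵀ + 1 k̄ᵀ`, `Λ = diag (k²)`, together with
`K_x = 2 i g φᵀ` and `K_t = 4 i (Λ g φᵀ + g φᵀ Λ̄)`, closes the derivatives of `u = φ K⁻¹ 1` and
`w = φ K⁻¹ g` to
`u_x = -2 i (u₁ + w u)`, `w_x = 2 i u h` and `i u_t + u_xx = 8 u² h`, where `u₁ = (Λ̄ φ) K⁻¹ 1` and
`h = k̄ K⁻¹ g`. Two identities between `K` and `Kᴴ` (`cauchyMatrix_mul_diagonal`,
`diagonal_mul_cauchyMatrix`) give `w + w̄ = -|u|²` and `h = ū w - ū₁`, whence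
`8 u² h = 4 i u² ū_x - 8 u³ ū²`. This is the Gerdjikov-Ivanov equation for `q = 2 i u`.
-/

namespace GerdjikovIvanov

/-! ### Invertibility of the soliton matrix -/

open Polynomial in
/-- Simple fractions with distinct poles are linearly independent, even as functions on an infinite
set `S` of non-poles: clearing denominators gives a polynomial with infinitely many roots, and its
value at the pole `a j` isolates `c j`. -/
theorem eq_zero_of_sum_div_sub_eq_zero {ι : Type*} [Fintype ι] [DecidableEq ι] {a c : ι → ℂ}
    (ha : Function.Injective a) {S : Set ℂ} (hS : S.Infinite) (haS : ∀ j, a j ∉ S)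
    (h : ∀ s ∈ S, ∑ j, c j / (s - a j) = 0) : c = 0 := by
  set P : ℂ[X] := ∑ j, C (c j) * ∏ m ∈ Finset.univ.erase j, (X - C (a m)) with hP
  have hP0 : P = 0 := by
    refine Polynomial.eq_zero_of_infinite_isRoot P (hS.mono fun s hs => ?_)
    have hsa : ∀ j, s - a j ≠ 0 := fun j h0 => haS j (by rwa [← sub_eq_zero.mp h0])
    have : P.eval s = (∏ m, (s - a m)) * ∑ j, c j / (s - a j) := by
      simp only [hP, eval_finsetSum, eval_mul, eval_C, eval_prod, eval_sub, eval_X,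
        Finset.mul_sum]
      refine Finset.sum_congr rfl fun j _ => ?_
      rw [← Finset.mul_prod_erase _ _ (Finset.mem_univ j)]
      field_simp [hsa j]
    simp [IsRoot, this, h s hs]
  ext j
  have hj : P.eval (a j) = c j * ∏ m ∈ Finset.univ.erase j, (a j - a m) := by
    simp only [hP, eval_finsetSum, eval_mul, eval_C, eval_prod, eval_sub, eval_X]
    refine Finset.sum_eq_single j (fun i _ hij => ?_) (by simp)
    rw [Finset.prod_eq_zero (Finset.mem_erase.mpr ⟨hij.symm, Finset.mem_univ j⟩) (sub_self _),
      mul_zero]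
  rw [hP0, eval_zero] at hj
  refine (mul_eq_zero.mp hj.symm).resolve_right (Finset.prod_ne_zero_iff.mpr fun m hm => ?_)
  exact sub_ne_zero.mpr fun h0 => (Finset.ne_of_mem_erase hm) (ha h0).symm

/-- The soliton matrix in terms of the spectral data `k` and of the values `f = p²`, which carry
the whole dependence on `(x, t)`. -/
noncomputable def cauchyMatrix {ι : Type*} (k f : ι → ℂ) : Matrix ι ι ℂ :=
  Matrix.of fun j l => (k j * f j * conj (f l) + conj (k l)) / (k j ^ 2 - conj (k l) ^ 2)

variable {ι : Type*}

section Invertibility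

variable [Fintype ι] [DecidableEq ι] {k f : ι → ℂ}

/-- The soliton matrix is invertible when the points `k j ^ 2` and their conjugates are pairwise
distinct. For a left null vector `c`, put `w₁ = ∑ c k f / (s - k²)` and `w₂ = ∑ c / (s - k²)`. The
partial fraction expansion of `w₁ w̄₁ + s w₂ w̄₂` has coefficients proportional to the entries of
`c K` and their conjugates, so it vanishes; for real `s > 0` it is a sum of squares, which forces
`w₂ = 0` and then `c = 0`. -/
theorem det_cauchyMatrix_ne_zero (hk : ∀ j l, j ≠ l → k j ^ 2 ≠ k l ^ 2)
    (hk' : ∀ j l, k j ^ 2 ≠ conj (k l) ^ 2) : (cauchyMatrix k f).det ≠ 0 := by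
  intro hdet
  obtain ⟨c, hc, hcK⟩ := Matrix.exists_vecMul_eq_zero_iff.mpr hdet
  have hK : ∀ l, ∑ j, c j * cauchyMatrix k f j l = 0 := fun l => congrFun hcK l
  -- A real `k j ^ 2` would equal its own conjugate.
  have hreal : ∀ (s : ℝ) j, (s : ℂ) ≠ k j ^ 2 := by
    intro s j h
    apply hk' j j
    rw [← map_pow, ← h, Complex.conj_ofReal]
  refine hc (eq_zero_of_sum_div_sub_eq_zero (a := fun j => k j ^ 2)
    (S := Complex.ofReal '' Set.Ioi 0) ?_ ?_ ?_ ?_)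
  · intro i j h
    by_contra hij
    exact hk i j hij h
  · exact (Set.Ioi_infinite 0).image Complex.ofReal_injective.injOn
  · rintro j ⟨s, -, hs⟩
    exact hreal s j hs
  rintro _ ⟨s, hs, rfl⟩
  set w₁ : ℂ := ∑ j, c j * k j * f j / (s - k j ^ 2) with hw₁
  set w₂ : ℂ := ∑ j, c j / (s - k j ^ 2) with hw₂
  have key : w₁ * conj w₁ + s * (w₂ * conj w₂) = 0 := by
    have hterm : ∀ j l, c j * k j * f j / (s - k j ^ 2) * conj (c l * k l * f l / (s - k l ^ 2))
        + s * (c j / (s - k j ^ 2) * conj (c l / (s - k l ^ 2)))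
        = -(c j * k j / (s - k j ^ 2) * conj (c l * cauchyMatrix k f l j))
          - conj (c l * k l / (s - k l ^ 2)) * (c j * cauchyMatrix k f j l) := by
      intro j l
      have h1 : (s : ℂ) - k j ^ 2 ≠ 0 := sub_ne_zero.mpr (hreal s j)
      have h2 : (s : ℂ) - conj (k l) ^ 2 ≠ 0 := by
        rw [← Complex.conj_ofReal s, ← map_pow, ← map_sub]
        exact (map_ne_zero (starRingEnd ℂ)).mpr (sub_ne_zero.mpr (hreal s l))
      have h3 : k j ^ 2 - conj (k l) ^ 2 ≠ 0 := sub_ne_zero.mpr (hk' j l)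
      have h4 : conj (k l) ^ 2 - k j ^ 2 = -(k j ^ 2 - conj (k l) ^ 2) := by ring
      simp only [cauchyMatrix, Matrix.of_apply, map_mul, map_div₀, map_sub, map_pow, map_add,
        Complex.conj_ofReal, Complex.conj_conj]
      rw [h4]
      field_simp
      ring
    calc w₁ * conj w₁ + s * (w₂ * conj w₂)
        = ∑ j, ∑ l, (c j * k j * f j / (s - k j ^ 2) * conj (c l * k l * f l / (s - k l ^ 2))
          + s * (c j / (s - k j ^ 2) * conj (c l / (s - k l ^ 2)))) := by
          rw [hw₁, hw₂, map_sum, map_sum, Finset.sum_mul_sum, Finset.sum_mul_sum]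
          simp only [Finset.mul_sum, Finset.sum_add_distrib]
      _ = ∑ j, ∑ l, -(c j * k j / (s - k j ^ 2) * conj (c l * cauchyMatrix k f l j))
          - ∑ l, ∑ j, conj (c l * k l / (s - k l ^ 2)) * (c j * cauchyMatrix k f j l) := by
          simp only [hterm, Finset.sum_sub_distrib]
          rw [Finset.sum_comm (f := fun j l =>
            conj (c l * k l / (s - k l ^ 2)) * (c j * cauchyMatrix k f j l))]
      _ = 0 := by
          simp only [Finset.sum_neg_distrib, ← Finset.mul_sum, ← map_sum, hK]
          simp
  rw [Complex.mul_conj, Complex.mul_conj] at key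
  have key' : Complex.normSq w₁ + s * Complex.normSq w₂ = 0 := by exact_mod_cast key
  have hs' : (0 : ℝ) < s := hs
  have h0 : s * Complex.normSq w₂ = 0 :=
    le_antisymm (by linarith [Complex.normSq_nonneg w₁])
      (mul_nonneg hs'.le (Complex.normSq_nonneg w₂))
  exact Complex.normSq_eq_zero.mp ((mul_eq_zero.mp h0).resolve_left hs'.ne')

end Invertibility

/-! ### Displacement identities for the soliton matrix and its inverse -/

section Displacement

variable [Fintype ι]

theorem dotProduct_mul_vecMulVec_mul_mulVec (M M' : Matrix ι ι ℂ) (a b v w : ι → ℂ) :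
    a ⬝ᵥ (M * vecMulVec v w * M') *ᵥ b = (a ⬝ᵥ M *ᵥ v) * (w ⬝ᵥ M' *ᵥ b) := by
  rw [mul_vecMulVec, vecMulVec_mul, vecMulVec_mulVec, ← dotProduct_mulVec]
  simp [dotProduct_smul, mul_comm]

theorem star_dotProduct_mulVec (M : Matrix ι ι ℂ) (a b : ι → ℂ) :
    star (a ⬝ᵥ M *ᵥ b) = star b ⬝ᵥ Mᴴ *ᵥ star a := by
  rw [← star_dotProduct_star, star_mulVec, dotProduct_mulVec]

variable [DecidableEq ι] {k f : ι → ℂ}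

/-- The Sylvester equation of the soliton matrix: its displacement by the spectral parameters has
rank at most two. -/
theorem cauchyMatrix_sylvester (hk' : ∀ j l, k j ^ 2 ≠ conj (k l) ^ 2) :
    diagonal (k ^ 2) * cauchyMatrix k f - cauchyMatrix k f * diagonal (star k ^ 2)
      = vecMulVec (k * f) (star f) + vecMulVec 1 (star k) := by
  ext j l
  have h := sub_ne_zero.mpr (hk' j l)
  simp [diagonal_mul, mul_diagonal, vecMulVec_apply, cauchyMatrix]
  field_simp

/-- The soliton matrix is not skew-Hermitian, but is so up to the diagonal factors `k`, `k̄` and a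
rank one correction. This and `diagonal_mul_cauchyMatrix` are the source of all relations between
the pairings and their complex conjugates. -/
theorem cauchyMatrix_mul_diagonal (hk' : ∀ j l, k j ^ 2 ≠ conj (k l) ^ 2) :
    cauchyMatrix k f * diagonal (star k) + vecMulVec 1 1
      = -(diagonal k * (cauchyMatrix k f)ᴴ) := by
  ext j l
  have h := sub_ne_zero.mpr (hk' j l)
  have h5 : conj (k l) ^ 2 - k j ^ 2 = -(k j ^ 2 - conj (k l) ^ 2) := by ring
  simp [diagonal_mul, mul_diagonal, cauchyMatrix, conjTranspose_apply]
  rw [h5]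
  field_simp
  ring

theorem diagonal_mul_cauchyMatrix (hk' : ∀ j l, k j ^ 2 ≠ conj (k l) ^ 2) :
    diagonal k * cauchyMatrix k f
      = vecMulVec f (star f) - (cauchyMatrix k f)ᴴ * diagonal (star k) := by
  ext j l
  have h := sub_ne_zero.mpr (hk' j l)
  have h5 : conj (k l) ^ 2 - k j ^ 2 = -(k j ^ 2 - conj (k l) ^ 2) := by ring
  simp [diagonal_mul, mul_diagonal, vecMulVec_apply, cauchyMatrix, conjTranspose_apply]
  rw [h5]
  field_simp
  ring

/-- The bilinear form `aᵀ K⁻¹ b` of the inverse soliton matrix. -/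
noncomputable def pairing (k f a b : ι → ℂ) : ℂ := a ⬝ᵥ (cauchyMatrix k f)⁻¹ *ᵥ b

theorem dotProduct_mul_diagonal_mulVec (M : Matrix ι ι ℂ) (a b d : ι → ℂ) :
    a ⬝ᵥ (M * diagonal d) *ᵥ b = a ⬝ᵥ M *ᵥ (d * b) := by
  rw [← mulVec_mulVec]
  congr 2
  ext i
  simp [mulVec_diagonal]

theorem dotProduct_diagonal_mul_mulVec (M : Matrix ι ι ℂ) (a b d : ι → ℂ) :
    a ⬝ᵥ (diagonal d * M) *ᵥ b = (d * a) ⬝ᵥ M *ᵥ b := by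
  rw [← mulVec_mulVec]
  simp [dotProduct, mulVec_diagonal]
  exact Finset.sum_congr rfl fun i _ => by ring

/-- The Sylvester equation, sandwiched between two copies of the inverse. -/
theorem pairing_sq_mul (hk' : ∀ j l, k j ^ 2 ≠ conj (k l) ^ 2) (hdet : (cauchyMatrix k f).det ≠ 0)
    (a b : ι → ℂ) :
    pairing k f a (k ^ 2 * b) = pairing k f (star k ^ 2 * a) b
      + pairing k f a (k * f) * pairing k f (star f) b
      + pairing k f a 1 * pairing k f (star k) b := by
  have hu : IsUnit (cauchyMatrix k f).det := hdet.isUnit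
  have h := congrArg (fun M => a ⬝ᵥ ((cauchyMatrix k f)⁻¹ * M * (cauchyMatrix k f)⁻¹) *ᵥ b)
    (cauchyMatrix_sylvester (f := f) hk')
  simp only [mul_sub, sub_mul, mul_add, add_mul] at h
  rw [Matrix.mul_assoc (cauchyMatrix k f)⁻¹ (_ * cauchyMatrix k f), Matrix.mul_assoc _ _ _⁻¹,
    mul_nonsing_inv _ hu, ← Matrix.mul_assoc _ _ (diagonal (star k ^ 2)), nonsing_inv_mul _ hu,
    Matrix.mul_one, Matrix.one_mul, sub_mulVec, add_mulVec, dotProduct_sub, dotProduct_add,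
    dotProduct_mul_vecMulVec_mul_mulVec, dotProduct_mul_vecMulVec_mul_mulVec,
    dotProduct_mul_diagonal_mulVec, dotProduct_diagonal_mul_mulVec] at h
  unfold pairing
  linear_combination h

/-- `cauchyMatrix_mul_diagonal`, multiplied by `K⁻¹` on the left and by `(Kᴴ)⁻¹` on the right. -/
theorem star_pairing_add (hk' : ∀ j l, k j ^ 2 ≠ conj (k l) ^ 2)
    (hdet : (cauchyMatrix k f).det ≠ 0) (a b : ι → ℂ) :
    star (pairing k f (star b) (k * star a)) + pairing k f a 1 * star (pairing k f (star b) 1)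
      = -pairing k f a (k * b) := by
  have hu : IsUnit (cauchyMatrix k f).det := hdet.isUnit
  have hu' : IsUnit (cauchyMatrix k f)ᴴ.det := by
    rw [det_conjTranspose]; exact hu.star
  have h := congrArg (fun M => a ⬝ᵥ ((cauchyMatrix k f)⁻¹ * M * (cauchyMatrix k f)ᴴ⁻¹) *ᵥ b)
    (cauchyMatrix_mul_diagonal (f := f) hk')
  simp only [mul_add, add_mul, mul_neg, neg_mul] at h
  rw [← Matrix.mul_assoc _ (cauchyMatrix k f), nonsing_inv_mul _ hu, Matrix.one_mul,
    Matrix.mul_assoc _ (_ * _) _, Matrix.mul_assoc _ (cauchyMatrix k f)ᴴ,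
    mul_nonsing_inv _ hu', Matrix.mul_one, add_mulVec, neg_mulVec, dotProduct_add, dotProduct_neg,
    dotProduct_mul_vecMulVec_mul_mulVec, dotProduct_mul_diagonal_mulVec,
    dotProduct_diagonal_mul_mulVec] at h
  simp only [pairing, star_dotProduct_mulVec, conjTranspose_nonsing_inv, star_star, star_mul',
    star_one]
  exact h

/-- `diagonal_mul_cauchyMatrix`, multiplied by `(Kᴴ)⁻¹` on the left and by `K⁻¹` on the right. -/
theorem pairing_star_mul (hk' : ∀ j l, k j ^ 2 ≠ conj (k l) ^ 2)
    (hdet : (cauchyMatrix k f).det ≠ 0) (a b : ι → ℂ) :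
    pairing k f (star k * a) b
      = star (pairing k f (star f) (star a)) * pairing k f (star f) b
        - star (pairing k f (star k * star b) (star a)) := by
  have hu : IsUnit (cauchyMatrix k f).det := hdet.isUnit
  have hu' : IsUnit (cauchyMatrix k f)ᴴ.det := by
    rw [det_conjTranspose]; exact hu.star
  have h := congrArg (fun M => a ⬝ᵥ ((cauchyMatrix k f)ᴴ⁻¹ * M * (cauchyMatrix k f)⁻¹) *ᵥ b)
    (diagonal_mul_cauchyMatrix (f := f) hk')
  simp only [mul_sub, sub_mul] at h
  rw [← Matrix.mul_assoc _ (cauchyMatrix k f)ᴴ, nonsing_inv_mul _ hu', Matrix.one_mul,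
    Matrix.mul_assoc _ (_ * _) _, Matrix.mul_assoc _ (cauchyMatrix k f),
    mul_nonsing_inv _ hu, Matrix.mul_one, sub_mulVec, dotProduct_sub,
    dotProduct_mul_vecMulVec_mul_mulVec, dotProduct_mul_diagonal_mulVec,
    dotProduct_diagonal_mul_mulVec] at h
  simp only [pairing, star_dotProduct_mulVec, conjTranspose_nonsing_inv, star_star, star_mul']
  linear_combination h

end Displacement

/-! ### Derivatives of the pairings -/

section Derivatives

variable {k : ι → ℂ} {f a b : ℝ → ι → ℂ} {a' b' : ι → ℂ} {s : ℝ}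

/-- Under a linear flow `f' = μ f` the summands `k̄ l / (k j ² - k̄ l ²)` of the entries stay
constant and the others satisfy `y' = (μ j + μ̄ l) y`. -/
theorem hasDerivAt_cauchyMatrix {μ : ι → ℂ} (hf : HasDerivAt f (μ * f s) s) (j l : ι) :
    HasDerivAt (fun σ => cauchyMatrix k (f σ) j l)
      ((μ j + conj (μ l)) * (k j * f s j * conj (f s l)) / (k j ^ 2 - conj (k l) ^ 2)) s := by
  have h1 := hasDerivAt_pi.mp hf j
  have h2 := (hasDerivAt_pi.mp hf l).star
  have h := (((h1.const_mul (k j)).mul h2).add_const (conj (k l))).div_const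
    (k j ^ 2 - conj (k l) ^ 2)
  refine h.congr_deriv ?_
  simp
  ring

variable [Fintype ι]

theorem hasDerivAt_dotProduct_mulVec {M : ℝ → Matrix ι ι ℂ} {M' : Matrix ι ι ℂ}
    {a b : ℝ → ι → ℂ} {a' b' : ι → ℂ} {s : ℝ} (ha : HasDerivAt a a' s) (hb : HasDerivAt b b' s)
    (hM : ∀ j l, HasDerivAt (fun σ => M σ j l) (M' j l) s) :
    HasDerivAt (fun σ => a σ ⬝ᵥ M σ *ᵥ b σ)
      (a' ⬝ᵥ M s *ᵥ b s + a s ⬝ᵥ M s *ᵥ b' + a s ⬝ᵥ M' *ᵥ b s) s := by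
  have h : HasDerivAt (fun σ => ∑ j, a σ j * ∑ l, M σ j l * b σ l)
      (∑ j, (a' j * ∑ l, M s j l * b s l
        + a s j * ∑ l, (M' j l * b s l + M s j l * b' l))) s :=
    .fun_sum fun j _ => (hasDerivAt_pi.mp ha j).mul
      (.fun_sum fun l _ => (hM j l).mul (hasDerivAt_pi.mp hb l))
  refine h.congr_deriv ?_
  simp only [dotProduct, mulVec, Finset.sum_add_distrib, mul_add]
  ring

theorem hasDerivAt_star_x (hf : HasDerivAt f ((fun j => 2 * Complex.I * k j ^ 2) * f s) s) :
    HasDerivAt (fun σ => star (f σ)) ((-(2 * Complex.I)) • (star k ^ 2 * star (f s))) s := by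
  refine HasDerivAt.congr_deriv hf.star ?_
  ext j
  simp
  ring

theorem hasDerivAt_star_t (hf : HasDerivAt f ((fun j => 4 * Complex.I * k j ^ 4) * f s) s) :
    HasDerivAt (fun σ => star (f σ))
      ((-(4 * Complex.I)) • (star k ^ 2 * (star k ^ 2 * star (f s)))) s := by
  refine HasDerivAt.congr_deriv hf.star ?_
  ext j
  simp
  ring

variable [DecidableEq ι]

open scoped Matrix.Norms.Operator in
theorem hasDerivAt_matrix_inv {K : ℝ → Matrix ι ι ℂ} {K' : Matrix ι ι ℂ} {s : ℝ}
    (hK : ∀ j l, HasDerivAt (fun σ => K σ j l) (K' j l) s) (hdet : (K s).det ≠ 0) (j l : ι) :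
    HasDerivAt (fun σ => (K σ)⁻¹ j l) ((-((K s)⁻¹ * K' * (K s)⁻¹)) j l) s := by
  have hK' : HasDerivAt K K' s := hasDerivAt_pi.mpr fun j => hasDerivAt_pi.mpr fun l => hK j l
  obtain ⟨U, hU⟩ := (isUnit_iff_isUnit_det (K s)).mpr hdet.isUnit
  have h := (hasFDerivAt_ringInverse (𝕜 := ℝ) U)
  rw [hU] at h
  have h2 := h.comp_hasDerivAt s hK'
  have h3 := hasDerivAt_pi.mp (hasDerivAt_pi.mp h2 j) l
  have e : (U⁻¹ : Matrix ι ι ℂ) = (K s)⁻¹ := by rw [← hU]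
  simpa [Function.comp_def, ← nonsing_inv_eq_ringInverse, e] using! h3

open scoped Matrix.Norms.Operator in
theorem contDiff_matrix_inv {E : Type*} [NormedAddCommGroup E] [NormedSpace ℝ E]
    {K : E → Matrix ι ι ℂ} (hK : ∀ j l, ContDiff ℝ ∞ fun z => K z j l)
    (hdet : ∀ z, (K z).det ≠ 0) (j l : ι) : ContDiff ℝ ∞ fun z => (K z)⁻¹ j l := by
  -- The operator norm is not the sup norm of the entries, so smoothness is carried between a matrix
  -- and its entries by linear maps.
  have hK' : ContDiff ℝ ∞ K := by
    have h : K = fun z => ∑ j, ∑ l, K z j l • Matrix.single j l (1 : ℂ) := by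
      funext z
      conv_lhs => rw [matrix_eq_sum_single (K z)]
      simp
    rw [h]
    exact .sum fun j _ => .sum fun l _ => (hK j l).smul contDiff_const
  have h : ContDiff ℝ ∞ fun z => (K z)⁻¹ := by
    rw [contDiff_iff_contDiffAt]
    intro z
    obtain ⟨U, hU⟩ := (isUnit_iff_isUnit_det (K z)).mpr (hdet z).isUnit
    have h := contDiffAt_ringInverse ℝ (n := ∞) U
    rw [hU] at h
    simp only [nonsing_inv_eq_ringInverse]
    exact h.comp z hK'.contDiffAt
  exact (LinearMap.toContinuousLinearMap (entryLinearMap ℝ ℂ j l)).contDiff.comp h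

/-- Derivative of a pairing along the `x`-flow `f' = 2 i k² f`, for which the derivative of the
soliton matrix has rank at most one. -/
theorem hasDerivAt_pairing_x (hk' : ∀ j l, k j ^ 2 ≠ conj (k l) ^ 2)
    (hdet : (cauchyMatrix k (f s)).det ≠ 0)
    (hf : HasDerivAt f ((fun j => 2 * Complex.I * k j ^ 2) * f s) s)
    (ha : HasDerivAt a a' s) (hb : HasDerivAt b b' s) :
    HasDerivAt (fun σ => pairing k (f σ) (a σ) (b σ))
      (pairing k (f s) a' (b s) + pairing k (f s) (a s) b'
        - 2 * Complex.I * (pairing k (f s) (a s) (k * f s)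
          * pairing k (f s) (star (f s)) (b s))) s := by
  have hK : ∀ j l, HasDerivAt (fun σ => cauchyMatrix k (f σ) j l)
      (((2 * Complex.I) • vecMulVec (k * f s) (star (f s)) : Matrix ι ι ℂ) j l) s := by
    intro j l
    refine (hasDerivAt_cauchyMatrix hf j l).congr_deriv ?_
    have h := sub_ne_zero.mpr (hk' j l)
    simp [vecMulVec_apply, map_ofNat]
    field_simp
    ring
  have h := hasDerivAt_dotProduct_mulVec (M := fun σ => (cauchyMatrix k (f σ))⁻¹)
    (M' := -((cauchyMatrix k (f s))⁻¹ *
    ((2 * Complex.I) • vecMulVec (k * f s) (star (f s))) * (cauchyMatrix k (f s))⁻¹))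
    ha hb (hasDerivAt_matrix_inv hK hdet)
  refine h.congr_deriv ?_
  rw [neg_mulVec, dotProduct_neg, Matrix.mul_smul, Matrix.smul_mul, smul_mulVec, dotProduct_smul,
    dotProduct_mul_vecMulVec_mul_mulVec, smul_eq_mul]
  simp only [pairing]
  ring

/-- Derivative of a pairing along the `t`-flow `f' = 4 i k⁴ f`, for which the derivative of the
soliton matrix has rank at most two. -/
theorem hasDerivAt_pairing_t (hk' : ∀ j l, k j ^ 2 ≠ conj (k l) ^ 2)
    (hdet : (cauchyMatrix k (f s)).det ≠ 0)
    (hf : HasDerivAt f ((fun j => 4 * Complex.I * k j ^ 4) * f s) s)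
    (ha : HasDerivAt a a' s) (hb : HasDerivAt b b' s) :
    HasDerivAt (fun σ => pairing k (f σ) (a σ) (b σ))
      (pairing k (f s) a' (b s) + pairing k (f s) (a s) b'
        - 4 * Complex.I * (pairing k (f s) (a s) (k ^ 2 * (k * f s))
            * pairing k (f s) (star (f s)) (b s)
          + pairing k (f s) (a s) (k * f s)
            * pairing k (f s) (star k ^ 2 * star (f s)) (b s))) s := by
  have hK : ∀ j l, HasDerivAt (fun σ => cauchyMatrix k (f σ) j l)
      (((4 * Complex.I) • (vecMulVec (k ^ 2 * (k * f s)) (star (f s))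
        + vecMulVec (k * f s) (star k ^ 2 * star (f s))) : Matrix ι ι ℂ) j l) s := by
    intro j l
    refine (hasDerivAt_cauchyMatrix hf j l).congr_deriv ?_
    have h := sub_ne_zero.mpr (hk' j l)
    simp [vecMulVec_apply, map_ofNat]
    field_simp
    ring
  have h := hasDerivAt_dotProduct_mulVec (M := fun σ => (cauchyMatrix k (f σ))⁻¹)
    (M' := -((cauchyMatrix k (f s))⁻¹ *
    ((4 * Complex.I) • (vecMulVec (k ^ 2 * (k * f s)) (star (f s))
        + vecMulVec (k * f s) (star k ^ 2 * star (f s)))) * (cauchyMatrix k (f s))⁻¹))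
    ha hb (hasDerivAt_matrix_inv hK hdet)
  refine h.congr_deriv ?_
  rw [neg_mulVec, dotProduct_neg, Matrix.mul_smul, Matrix.smul_mul, smul_mulVec, dotProduct_smul,
    Matrix.mul_add, Matrix.add_mul, add_mulVec, dotProduct_add,
    dotProduct_mul_vecMulVec_mul_mulVec, dotProduct_mul_vecMulVec_mul_mulVec, smul_eq_mul]
  simp only [pairing]
  ring

end Derivatives

/-! ### The evolution of the reduced potential -/

section Evolution

variable [Fintype ι] [DecidableEq ι] {k : ι → ℂ} {f : ℝ → ι → ℂ} {s : ℝ}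

theorem pairing_smul_left (k f a b : ι → ℂ) (c : ℂ) :
    pairing k f (c • a) b = c * pairing k f a b := by
  simp [pairing]

theorem pairing_smul_right (k f a b : ι → ℂ) (c : ℂ) :
    pairing k f a (c • b) = c * pairing k f a b := by
  simp [pairing, mulVec_smul]

theorem pairing_zero_right (k f a : ι → ℂ) : pairing k f a 0 = 0 := by
  simp [pairing]

/-- The reduced potential `u = φ K⁻¹ 1` with `φ = f̄`; the soliton is `2 i u`. -/
noncomputable def reducedPotential (k f : ι → ℂ) : ℂ := pairing k f (star f) 1

/-- The auxiliary scalar `w = φ K⁻¹ g` with `φ = f̄`, `g = k f`. -/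
noncomputable def auxiliaryPotential (k f : ι → ℂ) : ℂ := pairing k f (star f) (k * f)

/-- The relation `w + w̄ = -|u|²`, from the pairing of `φ = f̄` with `f`. -/
theorem star_auxiliaryPotential (hk' : ∀ j l, k j ^ 2 ≠ conj (k l) ^ 2) {f : ι → ℂ}
    (hdet : (cauchyMatrix k f).det ≠ 0) :
    star (auxiliaryPotential k f) = -auxiliaryPotential k f
      - reducedPotential k f * star (reducedPotential k f) := by
  have h := star_pairing_add hk' hdet (star f) f
  rw [star_star] at h
  unfold auxiliaryPotential reducedPotential
  linear_combination h

/-- The relation `h = ū w - ū₁`, where `h = k̄ K⁻¹ g` and `u₁ = (k̄² φ) K⁻¹ 1`, from the pairing of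
the constant vector with `g`. -/
theorem pairing_star_mul_self (hk' : ∀ j l, k j ^ 2 ≠ conj (k l) ^ 2) {f : ι → ℂ}
    (hdet : (cauchyMatrix k f).det ≠ 0) :
    pairing k f (star k) (k * f) = star (reducedPotential k f) * auxiliaryPotential k f
      - star (pairing k f (star k ^ 2 * star f) 1) := by
  have h := pairing_star_mul hk' hdet 1 (k * f)
  rw [star_one, mul_one, star_mul', ← mul_assoc, ← sq] at h
  exact h

theorem hasDerivAt_reducedPotential_x (hk' : ∀ j l, k j ^ 2 ≠ conj (k l) ^ 2)
    (hdet : (cauchyMatrix k (f s)).det ≠ 0)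
    (hf : HasDerivAt f ((fun j => 2 * Complex.I * k j ^ 2) * f s) s) :
    HasDerivAt (fun σ => reducedPotential k (f σ))
      (-2 * Complex.I * (pairing k (f s) (star k ^ 2 * star (f s)) 1
        + auxiliaryPotential k (f s) * reducedPotential k (f s))) s := by
  refine (hasDerivAt_pairing_x hk' hdet hf (hasDerivAt_star_x hf)
    (hasDerivAt_const s 1)).congr_deriv ?_
  rw [pairing_smul_left, pairing_zero_right]
  unfold auxiliaryPotential reducedPotential
  ring

theorem hasDerivAt_auxiliaryPotential_x (hk' : ∀ j l, k j ^ 2 ≠ conj (k l) ^ 2)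
    (hdet : (cauchyMatrix k (f s)).det ≠ 0)
    (hf : HasDerivAt f ((fun j => 2 * Complex.I * k j ^ 2) * f s) s) :
    HasDerivAt (fun σ => auxiliaryPotential k (f σ))
      (2 * Complex.I * (reducedPotential k (f s) * pairing k (f s) (star k) (k * f s))) s := by
  have hg : HasDerivAt (fun σ => k * f σ) ((2 * Complex.I) • (k ^ 2 * (k * f s))) s := by
    refine hasDerivAt_pi.mpr fun j => ?_
    refine HasDerivAt.congr_deriv ((hasDerivAt_pi.mp hf j).const_mul (k j)) ?_
    simp
    ring
  refine HasDerivAt.congr_deriv (hasDerivAt_pairing_x hk' hdet hf (hasDerivAt_star_x hf) hg) ?_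
  rw [pairing_smul_left, pairing_smul_right, pairing_sq_mul hk' hdet]
  unfold reducedPotential
  ring

theorem hasDerivAt_pairing_sq_star_x (hk' : ∀ j l, k j ^ 2 ≠ conj (k l) ^ 2)
    (hdet : (cauchyMatrix k (f s)).det ≠ 0)
    (hf : HasDerivAt f ((fun j => 2 * Complex.I * k j ^ 2) * f s) s) :
    HasDerivAt (fun σ => pairing k (f σ) (star k ^ 2 * star (f σ)) 1)
      (-2 * Complex.I * (pairing k (f s) (star k ^ 2 * (star k ^ 2 * star (f s))) 1
        + pairing k (f s) (star k ^ 2 * star (f s)) (k * f s) * reducedPotential k (f s))) s := by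
  have ha : HasDerivAt (fun σ => star k ^ 2 * star (f σ))
      ((-(2 * Complex.I)) • (star k ^ 2 * (star k ^ 2 * star (f s)))) s := by
    refine hasDerivAt_pi.mpr fun j => ?_
    refine HasDerivAt.congr_deriv
      ((hasDerivAt_pi.mp (hasDerivAt_star_x hf) j).const_mul ((star k ^ 2) j)) ?_
    simp
    ring
  refine HasDerivAt.congr_deriv (hasDerivAt_pairing_x hk' hdet hf ha (hasDerivAt_const s 1)) ?_
  rw [pairing_smul_left, pairing_zero_right]
  unfold reducedPotential
  ring

theorem hasDerivAt_reducedPotential_t (hk' : ∀ j l, k j ^ 2 ≠ conj (k l) ^ 2)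
    (hdet : (cauchyMatrix k (f s)).det ≠ 0)
    (hf : HasDerivAt f ((fun j => 4 * Complex.I * k j ^ 4) * f s) s) :
    HasDerivAt (fun σ => reducedPotential k (f σ))
      (-4 * Complex.I * (pairing k (f s) (star k ^ 2 * (star k ^ 2 * star (f s))) 1
        + (pairing k (f s) (star k ^ 2 * star (f s)) (k * f s) + auxiliaryPotential k (f s) ^ 2
          + reducedPotential k (f s) * pairing k (f s) (star k) (k * f s))
          * reducedPotential k (f s)
        + auxiliaryPotential k (f s) * pairing k (f s) (star k ^ 2 * star (f s)) 1)) s := by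
  refine (hasDerivAt_pairing_t hk' hdet hf (hasDerivAt_star_t hf)
    (hasDerivAt_const s 1)).congr_deriv ?_
  rw [pairing_smul_left, pairing_zero_right, pairing_sq_mul hk' hdet]
  unfold auxiliaryPotential reducedPotential
  ring

/-- The `x`- and `t`-derivatives of `u`, `w` and of the moment `u₁ = (k̄² φ) K⁻¹ 1` combine to
`i u_t + u_xx = 8 u² h` with `h = k̄ K⁻¹ g`, and the conjugation relations for `w` and `h` turn the
right-hand side into `4 i u² ū_x - 8 u³ ū²`, which is the equation for `q = 2 i u`. -/
theorem solvesGI_reducedPotential (hk' : ∀ j l, k j ^ 2 ≠ conj (k l) ^ 2)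
    {F : ℝ → ℝ → ι → ℂ} (hdet : ∀ x t, (cauchyMatrix k (F x t)).det ≠ 0)
    (hx : ∀ x t, HasDerivAt (fun y => F y t) ((fun j => 2 * Complex.I * k j ^ 2) * F x t) x)
    (ht : ∀ x t, HasDerivAt (fun τ => F x τ) ((fun j => 4 * Complex.I * k j ^ 4) * F x t) t) :
    SolvesGI fun x t => 2 * Complex.I * reducedPotential k (F x t) := by
  intro x t
  have hqt := ((hasDerivAt_reducedPotential_t hk' (hdet x t) (ht x t)).const_mul
    (2 * Complex.I)).deriv
  have hqx := fun y =>
    (hasDerivAt_reducedPotential_x (f := fun y => F y t) hk' (hdet y t) (hx y t)).const_mul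
      (2 * Complex.I)
  have hqbar := (hqx x).star.deriv
  have hqxx := ((((hasDerivAt_pairing_sq_star_x
      (f := fun y => F y t) hk' (hdet x t) (hx x t)).fun_add
    ((hasDerivAt_auxiliaryPotential_x (f := fun y => F y t) hk' (hdet x t) (hx x t)).fun_mul
      (hasDerivAt_reducedPotential_x (f := fun y => F y t) hk' (hdet x t) (hx x t)))).const_mul
        (-2 * Complex.I)).const_mul (2 * Complex.I)).deriv
  have hd : (fun y => deriv (fun z => 2 * Complex.I * reducedPotential k (F z t)) y) = _ :=
    funext fun y => (hqx y).deriv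
  have hw := star_auxiliaryPotential hk' (hdet x t)
  have hh := pairing_star_mul_self hk' (hdet x t)
  simp only [Complex.star_def] at hqbar hw hh
  beta_reduce
  rw [hqt, hd, hqbar]
  refine (congrArg (fun z => _ + z - _ + _) hqxx).trans ?_
  simp only [map_mul, map_add, map_neg, map_ofNat, Complex.conj_I, hw, hh]
  generalize reducedPotential k (F x t) = u
  generalize auxiliaryPotential k (F x t) = w
  generalize pairing k (F x t) (star k ^ 2 * star (F x t)) 1 = u₁
  generalize pairing k (F x t) (star k ^ 2 * star (F x t)) (k * F x t) = w₁
  generalize pairing k (F x t) (star k ^ 2 * (star k ^ 2 * star (F x t))) 1 = u₂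
  linear_combination (16 * u ^ 2 * (conj u₁ - w * conj u) * Complex.I ^ 3) * Complex.I_sq

end Evolution

/-! ### The dressing system -/

theorem zeroSeedEigenfunction_eq (x t : ℝ) (z : ℂ) :
    zeroSeedEigenfunction x t z = diagonal ![Complex.exp (-(Complex.I * theta z x t)),
      Complex.exp (Complex.I * theta z x t)] := by
  have h : -(Complex.I * theta z x t) • σ₃
      = diagonal ![-(Complex.I * theta z x t), Complex.I * theta z x t] := by
    ext i j
    fin_cases i <;> fin_cases j <;> simp [σ₃]
  rw [zeroSeedEigenfunction, h, Matrix.exp_diagonal]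
  congr 1
  ext i
  rw [Pi.coe_exp, Complex.exp_eq_exp_ℂ]
  fin_cases i <;> simp

theorem σ₃_mul_mul_σ₃ (A : Matrix (Fin 2) (Fin 2) ℂ) :
    σ₃ * A * σ₃ = !![A 0 0, -A 0 1; -A 1 0, A 1 1] := by
  conv_lhs => rw [eta_fin_two A]
  simp [σ₃]

variable {N : ℕ} {k b : Fin N → ℂ}

theorem aCoeff_ne_zero (hk : ∀ j l, j ≠ l → k j ^ 2 ≠ k l ^ 2)
    (hk' : ∀ j l, k j ^ 2 ≠ conj (k l) ^ 2) (j : Fin N) : aCoeff k j ≠ 0 := by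
  have hkj : k j ≠ 0 := fun h => hk' j j (by simp [h])
  refine mul_ne_zero (div_ne_zero (by simpa using hkj) (sub_ne_zero.mpr (hk' j j)))
    (Finset.prod_ne_zero_iff.mpr fun m hm => div_ne_zero
      (sub_ne_zero.mpr (hk j m (Finset.ne_of_mem_erase hm).symm)) (sub_ne_zero.mpr (hk' j m)))

theorem p_ne_zero (hb : ∀ j, b j ≠ 0) (x t : ℝ) (j : Fin N) : p k b x t j ≠ 0 :=
  mul_ne_zero (hb j) (Complex.exp_ne_zero _)

theorem residue_zeroSeed (x t : ℝ) (v : Fin N → Fin 2 → ℂ) (j : Fin N) :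
    residue (zeroSeedEigenfunction x t) k b v j
      = (aCoeff k j)⁻¹ • vecMulVec (v j) ![p k b x t j, (p k b x t j)⁻¹] := by
  have hinv : (zeroSeedEigenfunction x t (k j))⁻¹ = diagonal
      ![Complex.exp (Complex.I * theta (k j) x t),
        Complex.exp (-(Complex.I * theta (k j) x t))] := by
    rw [zeroSeedEigenfunction_eq]
    refine inv_eq_right_inv ?_
    rw [diagonal_mul_diagonal, ← diagonal_one]
    congr 1
    ext i
    fin_cases i <;> simp [← Complex.exp_add]
  rw [residue, hinv, vecMulVec_mul]
  congr 2
  ext i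
  fin_cases i <;> simp [vecMul_diagonal, p, theta, Complex.exp_neg, mul_comm]

/-- The dressing system asks that the dressing factor at `k̄ l` annihilate `(p̄ l, p̄ l⁻¹)`. -/
theorem seed_vector (x t : ℝ) (l : Fin N) :
    σ₂ *ᵥ ((zeroSeedEigenfunction x t (k l)).map conj *ᵥ ![(conj (b l))⁻¹, -conj (b l)])
      = Complex.I • ![conj (p k b x t l), (conj (p k b x t l))⁻¹] := by
  rw [zeroSeedEigenfunction_eq]
  ext i
  fin_cases i <;>
    simp [σ₂, mulVec, dotProduct, Fin.sum_univ_two, p, theta, ← Complex.exp_conj, Complex.exp_neg]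
  ring

theorem solitonMatrix_eq (x t : ℝ) :
    solitonMatrix k b x t = cauchyMatrix k fun j => p k b x t j ^ 2 := by
  ext j l
  simp [solitonMatrix, cauchyMatrix]

/-- In the rescaled unknowns `r / (a p)` and `s / (a p)` the dressing system decouples into one
linear system for the soliton matrix and one for its conjugate transpose. -/
theorem dressingSystem_iff (hb : ∀ j, b j ≠ 0) (hk : ∀ j l, j ≠ l → k j ^ 2 ≠ k l ^ 2)
    (hk' : ∀ j l, k j ^ 2 ≠ conj (k l) ^ 2) (x t : ℝ) (v : Fin N → Fin 2 → ℂ) :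
    DressingSystem (zeroSeedEigenfunction x t) k b v ↔
      (fun j => v j 0 / (aCoeff k j * p k b x t j)) ᵥ* solitonMatrix k b x t
          = (fun l => conj (p k b x t l) ^ 2 / 2) ∧
      (fun j => v j 1 / (aCoeff k j * p k b x t j)) ᵥ* (solitonMatrix k b x t)ᴴ
          = fun _ => -(1 / 2) := by
  have hrow : ∀ l, dressingFactor k (residue (zeroSeedEigenfunction x t) k b v) (conj (k l)) *ᵥ
      (σ₂ *ᵥ ((zeroSeedEigenfunction x t (k l)).map conj *ᵥ ![(conj (b l))⁻¹, -conj (b l)]))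
      = (Complex.I * (2 / conj (p k b x t l))) •
        ![conj (p k b x t l) ^ 2 / 2
            - ∑ j, v j 0 / (aCoeff k j * p k b x t j) * solitonMatrix k b x t j l,
          1 / 2 + ∑ j, v j 1 / (aCoeff k j * p k b x t j) * (solitonMatrix k b x t)ᴴ j l] := by
    intro l
    have hpl : conj (p k b x t l) ≠ 0 := (map_ne_zero (starRingEnd ℂ)).mpr (p_ne_zero hb x t l)
    rw [seed_vector, mulVec_smul, mul_smul]
    congr 1
    simp only [dressingFactor, residue_zeroSeed, add_mulVec, one_mulVec, sum_mulVec]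
    have hd : ∀ j, conj (k l) - k j ≠ 0 ∧ conj (k l) + k j ≠ 0 := fun j => by
      rw [← mul_ne_zero_iff]
      have h := sub_ne_zero.mpr (hk' j l)
      contrapose! h
      linear_combination -h
    ext i
    fin_cases i
    · simp only [Pi.add_apply, Finset.sum_apply, mulVec, dotProduct, Fin.sum_univ_two,
        Matrix.sub_apply, Matrix.smul_apply, σ₃_mul_mul_σ₃, vecMulVec_apply]
      simp [solitonMatrix, mul_sub, Finset.mul_sum]
      rw [sub_eq_add_neg, ← Finset.sum_neg_distrib]
      congr 1
      · field_simp
      refine Finset.sum_congr rfl fun j _ => ?_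
      have h := sub_ne_zero.mpr (hk' j l)
      have h1 := (hd j).1
      have h2 := (hd j).2
      have h3 := p_ne_zero (k := k) hb x t j
      have h4 := aCoeff_ne_zero hk hk' j
      have h5 : k j ^ 2 - conj (k l) ^ 2 = -((conj (k l) - k j) * (conj (k l) + k j)) := by ring
      rw [h5]
      field_simp
      ring
    · simp only [Pi.add_apply, Finset.sum_apply, mulVec, dotProduct, Fin.sum_univ_two,
        Matrix.sub_apply, Matrix.smul_apply, σ₃_mul_mul_σ₃, vecMulVec_apply]
      simp [solitonMatrix, mul_add, Finset.mul_sum]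
      congr 1
      · field_simp
      refine Finset.sum_congr rfl fun j _ => ?_
      have h := sub_ne_zero.mpr (hk' j l)
      have h1 := (hd j).1
      have h2 := (hd j).2
      have h3 := p_ne_zero (k := k) hb x t j
      have h4 := aCoeff_ne_zero hk hk' j
      have h5 : conj (k l) ^ 2 - k j ^ 2 = (conj (k l) - k j) * (conj (k l) + k j) := by ring
      rw [h5]
      field_simp
      ring
  unfold DressingSystem
  simp only [hrow, funext_iff, vecMul, dotProduct]
  rw [← forall_and]
  refine forall_congr' fun l => ?_
  have hpl : conj (p k b x t l) ≠ 0 := (map_ne_zero (starRingEnd ℂ)).mpr (p_ne_zero hb x t l)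
  have hc : Complex.I * (2 / conj (p k b x t l)) ≠ 0 := by simpa using hpl
  simp only [Fin.forall_fin_two, Pi.smul_apply, Pi.zero_apply, smul_eq_mul, mul_eq_zero, hc,
    false_or, cons_val_zero, cons_val_one]
  rw [sub_eq_zero, eq_comm, add_comm, add_eq_zero_iff_eq_neg]

theorem existsUnique_dressingSystem (hb : ∀ j, b j ≠ 0) (hk : ∀ j l, j ≠ l → k j ^ 2 ≠ k l ^ 2)
    (hk' : ∀ j l, k j ^ 2 ≠ conj (k l) ^ 2) {x t : ℝ} (hdet : (solitonMatrix k b x t).det ≠ 0) :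
    ∃! v, DressingSystem (zeroSeedEigenfunction x t) k b v := by
  have hu : IsUnit (solitonMatrix k b x t).det := hdet.isUnit
  have hu' : IsUnit (solitonMatrix k b x t)ᴴ.det := by
    rw [det_conjTranspose]; exact hu.star
  have hc : ∀ j, aCoeff k j * p k b x t j ≠ 0 := fun j =>
    mul_ne_zero (aCoeff_ne_zero hk hk' j) (p_ne_zero hb x t j)
  simp only [dressingSystem_iff hb hk hk']
  set R := (fun l => conj (p k b x t l) ^ 2 / 2) ᵥ* (solitonMatrix k b x t)⁻¹ with hR
  set S := (fun _ => -(1 / 2)) ᵥ* (solitonMatrix k b x t)ᴴ⁻¹ with hS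
  refine ⟨fun j => ![aCoeff k j * p k b x t j * R j, aCoeff k j * p k b x t j * S j],
    ⟨?_, ?_⟩, ?_⟩
  · simp [hc, hR, vecMul_vecMul, nonsing_inv_mul _ hu]
  · simp [hc, hS, vecMul_vecMul, nonsing_inv_mul _ hu']
  · rintro v ⟨h1, h2⟩
    rw [← h1, vecMul_vecMul, mul_nonsing_inv _ hu, vecMul_one] at hR
    rw [← h2, vecMul_vecMul, mul_nonsing_inv _ hu', vecMul_one] at hS
    ext j i
    have h3 := aCoeff_ne_zero hk hk' j
    have h4 := p_ne_zero (k := k) hb x t j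
    fin_cases i <;> simp [hR, hS] <;> field_simp

theorem dressedPotential_eq (hb : ∀ j, b j ≠ 0) (hk : ∀ j l, j ≠ l → k j ^ 2 ≠ k l ^ 2)
    (hk' : ∀ j l, k j ^ 2 ≠ conj (k l) ^ 2) {x t : ℝ} (hdet : (solitonMatrix k b x t).det ≠ 0)
    {v : Fin N → Fin 2 → ℂ} (hv : DressingSystem (zeroSeedEigenfunction x t) k b v) :
    dressedPotential 0 (residue (zeroSeedEigenfunction x t) k b v) = solitonFormula k b x t := by
  have h := congrArg (· ᵥ* (solitonMatrix k b x t)⁻¹) ((dressingSystem_iff hb hk hk' x t v).mp hv).1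
  simp only [vecMul_vecMul, mul_nonsing_inv _ hdet.isUnit, vecMul_one] at h
  have hj : ∀ j, residue (zeroSeedEigenfunction x t) k b v j 0 1
      = ∑ l, conj (p k b x t l) ^ 2 / 2 * (solitonMatrix k b x t)⁻¹ l j := fun j => by
    have := congrFun h j
    simp only [vecMul, dotProduct] at this
    rw [← this, residue_zeroSeed]
    simp
    ring
  simp only [dressedPotential, solitonFormula, hj, zero_add]
  rw [Finset.sum_comm]
  simp only [Finset.mul_sum]
  refine Finset.sum_congr rfl fun l _ => Finset.sum_congr rfl fun j _ => ?_
  ring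

/-! ### The soliton formula -/

theorem solitonFormula_eq (x t : ℝ) :
    solitonFormula k b x t = 2 * Complex.I * reducedPotential k fun j => p k b x t j ^ 2 := by
  simp [solitonFormula, reducedPotential, pairing, solitonMatrix_eq, dotProduct, mulVec,
    Finset.mul_sum]

theorem hasDerivAt_p_sq_x (x t : ℝ) :
    HasDerivAt (fun y j => p k b y t j ^ 2)
      ((fun j => 2 * Complex.I * k j ^ 2) * fun j => p k b x t j ^ 2) x := by
  refine hasDerivAt_pi.mpr fun j => ?_
  have h := ((((((Complex.ofRealCLM.hasDerivAt (x := x)).const_mul (k j ^ 2)).add_const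
    (2 * k j ^ 4 * t)).const_mul Complex.I).cexp).const_mul (b j)).pow 2
  refine h.congr_deriv ?_
  simp [p]
  ring

theorem hasDerivAt_p_sq_t (x t : ℝ) :
    HasDerivAt (fun τ j => p k b x τ j ^ 2)
      ((fun j => 4 * Complex.I * k j ^ 4) * fun j => p k b x t j ^ 2) t := by
  refine hasDerivAt_pi.mpr fun j => ?_
  have h := ((((((Complex.ofRealCLM.hasDerivAt (x := t)).const_mul (2 * k j ^ 4)).const_add
    (k j ^ 2 * x)).const_mul Complex.I).cexp).const_mul (b j)).pow 2
  refine h.congr_deriv ?_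
  simp [p]
  ring

theorem contDiff_p (j : Fin N) : ContDiff ℝ ∞ fun z : ℝ × ℝ => p k b z.1 z.2 j := by
  have h1 : ContDiff ℝ ∞ fun z : ℝ × ℝ => (z.1 : ℂ) := Complex.ofRealCLM.contDiff.comp contDiff_fst
  have h2 : ContDiff ℝ ∞ fun z : ℝ × ℝ => (z.2 : ℂ) := Complex.ofRealCLM.contDiff.comp contDiff_snd
  exact contDiff_const.mul (contDiff_const.mul
    ((contDiff_const.mul h1).add (contDiff_const.mul h2))).cexp

theorem contDiff_solitonFormula (hdet : ∀ x t, (solitonMatrix k b x t).det ≠ 0) :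
    ContDiff ℝ ∞ fun z : ℝ × ℝ => solitonFormula k b z.1 z.2 := by
  have hc : ∀ l, ContDiff ℝ ∞ fun z : ℝ × ℝ => conj (p k b z.1 z.2 l) ^ 2 := fun l =>
    (Complex.conjCLE.contDiff.comp (contDiff_p l)).pow 2
  have hK : ∀ j l, ContDiff ℝ ∞ fun z : ℝ × ℝ => solitonMatrix k b z.1 z.2 j l := fun j l =>
    (((contDiff_const.mul ((contDiff_p j).pow 2)).mul (hc l)).add contDiff_const).div_const _
  exact contDiff_const.mul (.sum fun l _ => .sum fun j _ =>
    (hc l).mul (contDiff_matrix_inv hK (fun z => hdet z.1 z.2) l j))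

end GerdjikovIvanov

theorem mainTheorem2 {N : ℕ} (k b : Fin N → ℂ)
    (hb : ∀ j, b j ≠ 0)
    (hk : ∀ j l, j ≠ l → k j ^ 2 ≠ k l ^ 2)
    (hk' : ∀ j l, k j ^ 2 ≠ conj (k l) ^ 2) :
    (∀ x t : ℝ,
      (GerdjikovIvanov.solitonMatrix k b x t).det ≠ 0 ∧
      (∃! v : Fin N → Fin 2 → ℂ, GerdjikovIvanov.DressingSystem
        (GerdjikovIvanov.zeroSeedEigenfunction x t) k b v) ∧
      (∀ v : Fin N → Fin 2 → ℂ,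
        GerdjikovIvanov.DressingSystem (GerdjikovIvanov.zeroSeedEigenfunction x t) k b v →
        GerdjikovIvanov.dressedPotential 0
            (GerdjikovIvanov.residue (GerdjikovIvanov.zeroSeedEigenfunction x t) k b v)
          = GerdjikovIvanov.solitonFormula k b x t)) ∧
    ContDiff ℝ ∞ (fun z : ℝ × ℝ => GerdjikovIvanov.solitonFormula k b z.1 z.2) ∧
    GerdjikovIvanov.SolvesGI (GerdjikovIvanov.solitonFormula k b) := by
  open GerdjikovIvanov in
  have hdet : ∀ x t, (solitonMatrix k b x t).det ≠ 0 := fun x t => by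
    rw [solitonMatrix_eq]
    exact det_cauchyMatrix_ne_zero hk hk'
  refine ⟨fun x t => ⟨hdet x t, existsUnique_dressingSystem hb hk hk' (hdet x t),
    fun v hv => dressedPotential_eq hb hk hk' (hdet x t) hv⟩, contDiff_solitonFormula hdet, ?_⟩
  have hq : solitonFormula k b = fun x t => 2 * Complex.I * reducedPotential k fun j =>
      p k b x t j ^ 2 := funext₂ solitonFormula_eq
  rw [hq]
  exact solvesGI_reducedPotential hk' (F := fun x t j => p k b x t j ^ 2)
    (fun x t => det_cauchyMatrix_ne_zero hk hk') hasDerivAt_p_sq_x hasDerivAt_p_sq_t
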